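/- **Setting.** A $t$-$(m,q,k,\lambda)$ GDD $(\mathcal X,\mathcal G,\mathcal A)$ has a point set $\mathcal X$ partitioned into $m$ groups of size $q$ and a family $\mathcal A$ of $k$-subsets of $\mathcal X$ (blocks), each meeting every group in at most one point, such that every $t$-set of points from $t$ distinct groups lies in exactly $\lambda$ blocks. An $s$-$(q,m,1)$ OA is a $q^s\times m$ array $\mathbf D$ over a set $\mathcal Y$ of $q$ symbols such that within any $s$ columns every $s$-tuple occurs in exactly one row. An $F\times K$ array with entries $\star$ or symbols is a $(K,F,Z,S)$ PDA if each column has $Z$ stars, exactly $S$ distinct symbols occur, and any two distinct entries $p_{j_1,k_1}=p_{j_2,k_2}\neq\star$ satisfy $j_1\ne j_2$, $k_1\ne k_2$, $p_{j_1,k_2}=p_{j_2,k_1}=\star$. It is $g$-regular if every symbol occurs $g$ times. It is a DPDA if moreover there is a map $\phi$ from symbols to columns such that $p_{j,k}=s\neq\star$ implies $p_{j,\phi(s)}=\star$. An $F$-division $(L,K,\Gamma,M,N)$ multiaccess D2D coded caching (MADCC) scheme with access topology $\mathfrak B=\{\mathcal B_1,\dots,\mathcal B_K\}$ has $N\ge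 K$ files, each split into $F$ packets; $\Gamma$ cache nodes, each storing $MF$ packets uncoded and independently of the demands, where $M\ge N/(LK)$; and $K$ users without caches, user $k$ accessing a set $\mathcal B_k$ of $L$ nodes, the sets $\mathcal B_k$ being distinct. For each demand vector $d$ the users broadcast packet-sized messages, each computed from the cache contents its sender can access; every user must obtain each packet of its requested file $d_k$ either from the nodes it accesses, or from those contents together with one message of another user. The load $R$ is the maximum over $d$ of the total number of messages divided by $F$. **Theorem.** Let $1\le t<m$ and $q\ge1$, let $(\mathcal X,\mathcal G,\mathcal A)$ be a $t$-$(m,q,t,1)$ GDD and let $(\mathcal Y,\mathbf D)$ be an $(m-1)$-$(q,m,1)$ OA with rows $\vec D_j$. The points can be labelled as pairs $(u,v)$, $u\in[m]$, $v\in\mathcal Y$, so that the points of the $u$-th group are exactly those with first coordinate $u$; and for every such labelling the following holds. 1. Let $\mathbf P$ be the array with rows $j\in[q^{m-1}]$ and columns $A\in\mathcal A$ with $P_{j,A}=\star$ if $D_{j,u}=v$ for some $(u,v)\in A$, and otherwise $P_{j,A}=\vec e_{\alpha}$, where $\vec e$ is $\vec D_j$ with the entry at $u$ replaced by $v$ for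 each $(u,v)\in A$, and $\alpha$ is the occurrence number of $\vec e$ in column $A$, from top to bottom. Then $\mathbf P$ is a $\binom mt$-regular $\left(\binom mt q^t,\ q^{m-1},\ q^{m-1}-(q-1)^tq^{m-1-t},\ (q-1)^tq^{m-1}\right)$ PDA. 2. Split each row $j$ of $\mathbf P$ into $g=\binom mt-1$ rows $(j,a)$, keep the stars, and replace the $g$ copies of an entry $s$ in column $A$, in any order, by the $g$ symbols $(s,A')$, where $A'\ne A$ runs through the other columns that contain $s$. This is possible, and every array $\mathbf Q$ so obtained is, with $\phi(s,A')=A'$, a $$\left(\tbinom mt q^t,\ \left(\tbinom mt-1\right)q^{m-1},\ \left(\tbinom mt-1\right)q^{m-1}\left(1-\left(\tfrac{q-1}q\right)^t\right),\ \tbinom mt(q-1)^tq^{m-1}\right)\text{ DPDA}.$$ 3. Let the cache nodes be the points and the users the blocks, with $\mathfrak B=\mathcal A$. Let node $(u,v)$ store the packets $(j,a)$ of all files for which $D_{j,u}=v$. Then $Q_{(j,a),A}=\star$ if and only if user $A$ accesses a node that stores the packets $(j,a)$. For every number $N\ge\binom mt q^t$ of files and every packet length in bits, this placement, together with the delivery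 in which for each symbol $s$ of $\mathbf Q$ user $\phi(s)$ sends $\bigoplus_{Q_{f,A}=s}W_{d_A,f}$, is a $\left(\binom mt-1\right)q^{m-1}$-division $\left(t,\binom mt q^t,mq,M,N\right)$ MADCC scheme with access topology $\mathcal A$ and $$\left(\frac MN,\,R\right)=\left(\frac1q,\ \frac{\binom mt(q-1)^t}{\binom mt-1}\right).$$ -/

import Mathlib

/-- A uniform `t`-`(m, q, k, lam)` group divisible design: the point set is the whole type `X`, the
`m` groups are `G 0, …, G (m - 1)`, and the blocks form an indexed family `A`. -/
structure IsGDD {X B : Type*} [Fintype X] [Fintype B] (t m q k lam : ℕ)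
    (G : Fin m → Finset X) (A : B → Finset X) : Prop where
  group_disjoint : ∀ u v, u ≠ v → Disjoint (G u) (G v)
  group_cover : ∀ x, ∃ u, x ∈ G u
  group_card : ∀ u, (G u).card = q
  block_card : ∀ b, (A b).card = k
  block_group : ∀ b u, ∀ x ∈ A b, ∀ y ∈ A b, x ∈ G u → y ∈ G u → x = y
  index_eq : ∀ T : Finset X, T.card = t →
    (∀ u, ∀ x ∈ T, ∀ y ∈ T, x ∈ G u → y ∈ G u → x = y) →
    Nat.card {b : B // T ⊆ A b} = lam

/-- A `t`-`(v, r, lam)` orthogonal array on the symbol set `Y`, with `n` rows and `r` columns. -/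
structure IsOA {Y : Type*} [Fintype Y] (t v r lam : ℕ) {n : ℕ} (D : Fin n → Fin r → Y) :
    Prop where
  symbols_card : Fintype.card Y = v
  rows_card : n = lam * v ^ t
  strength : ∀ C : Finset (Fin r), C.card = t → ∀ w : Fin r → Y,
    Nat.card {j : Fin n // ∀ c ∈ C, D j c = w c} = lam

/-- `ρ` writes each point of the `u`-th group as a pair `(u, v)`. -/
def IsPointRepresentation {X Y : Type*} {m : ℕ} (G : Fin m → Finset X)
    (ρ : X ≃ Fin m × Y) : Prop :=
  ∀ x u, x ∈ G u ↔ (ρ x).1 = u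

/-! Arrays have rows in `Φ`, columns in `U`, and entries in `Option S`; `none` is the star. -/

open scoped Classical in
/-- The set of non-star symbols that occur in an array. -/
noncomputable def symbolSet {Φ U S : Type*} [Fintype Φ] [Fintype U] (P : Φ → U → Option S) :
    Finset S :=
  Finset.eraseNone (Finset.univ.image fun p : Φ × U => P p.1 p.2)

theorem mem_symbolSet {Φ U S : Type*} [Fintype Φ] [Fintype U] (P : Φ → U → Option S) (s : S) :
    s ∈ symbolSet P ↔ ∃ j k, P j k = some s := by
  simp [symbolSet]

/-- A `(K, F, Z, S)` placement delivery array. The symbols may be of any type; the array uses exactly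
`S` of them, each at least once. (`S = 0` is allowed.) -/
structure IsPDA {Φ U Λ : Type*} [Fintype Φ] [Fintype U] (P : Φ → U → Option Λ)
    (K F Z S : ℕ) : Prop where
  columns_card : Fintype.card U = K
  rows_card : Fintype.card Φ = F
  stars : ∀ k, Nat.card {j : Φ // P j k = none} = Z
  symbols : (symbolSet P).card = S
  distinct : ∀ j₁ k₁ j₂ k₂ s, P j₁ k₁ = some s → P j₂ k₂ = some s → (j₁, k₁) ≠ (j₂, k₂) →
    j₁ ≠ j₂ ∧ k₁ ≠ k₂ ∧ P j₁ k₂ = none ∧ P j₂ k₁ = none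

/-- Every symbol of the array occurs exactly `g` times. -/
def IsRegularArray {Φ U Λ : Type*} [Fintype Φ] [Fintype U] (P : Φ → U → Option Λ) (g : ℕ) : Prop :=
  ∀ s ∈ symbolSet P, Nat.card {p : Φ × U // P p.1 p.2 = some s} = g

/-- A `(K, F, Z, S)` DPDA, with `φ` the map from symbols to transmitting users. -/
structure IsDPDA {Φ U Λ : Type*} [Fintype Φ] [Fintype U] (P : Φ → U → Option Λ) (φ : Λ → U)
    (K F Z S : ℕ) : Prop extends IsPDA P K F Z S where
  sender : ∀ j k s, P j k = some s → P j (φ s) = none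

/-- `Q` arises from `P` by the transformation of regular PDAs into DPDAs: each row `j` is split into
the `g` rows `(j, a)`; stars stay stars; and the `g` copies of an entry `s` in column `k` become, in
some order, the symbols `(s, k')`, one for each *other* column `k'` in which `s` occurs. The message
`(s, k')` is to be sent by user `k'`. -/
structure IsD2DTransform {Φ U Λ : Type*} {g : ℕ} (P : Φ → U → Option Λ)
    (Q : Φ × Fin g → U → Option (Λ × U)) : Prop where
  star : ∀ j a k, P j k = none → Q (j, a) k = none
  entry : ∀ j k s, P j k = some s →
    Set.BijOn (fun a => Q (j, a) k) Set.univ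
      {o | ∃ k', k' ≠ k ∧ (∃ j', P j' k' = some s) ∧ o = some (s, k')}

/-! The multiaccess scheme of a group divisible design with blocks `A` and an orthogonal array `D`,
for designs in which the block size is `t`. -/

/-- Node-placement array: the cache node `x = (u, v)` stores the packet of row `j` iff
`D j u = v`. -/
def nodePlacement {X Y : Type*} {m n : ℕ} (D : Fin n → Fin m → Y) (ρ : X ≃ Fin m × Y)
    (j : Fin n) (x : X) : Prop :=
  D j (ρ x).1 = (ρ x).2

open scoped Classical in
/-- The row `d` with the entry in position `u` replaced by `v` for each point `(u, v)` of the
block `a` (a block has at most one point in each group). -/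
noncomputable def overwrite {X Y : Type*} {m : ℕ} (ρ : X ≃ Fin m × Y) (a : Finset X)
    (d : Fin m → Y) (u : Fin m) : Y :=
  if h : ∃ v, ρ.symm (u, v) ∈ a then h.choose else d u

open scoped Classical in
/-- User-retrieve array: star if some node accessible to the user stores the packet; otherwise the
overwritten row `e`, together with the occurrence number of `e` in that column (from top to
bottom). -/
noncomputable def userRetrieve {X Y B : Type*} {m n : ℕ} (D : Fin n → Fin m → Y)
    (ρ : X ≃ Fin m × Y) (A : B → Finset X) (j : Fin n) (b : B) : Option ((Fin m → Y) × ℕ) :=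
  if ∃ x ∈ A b, nodePlacement D ρ j x then none
  else some (overwrite ρ (A b) (D j),
    Nat.card {i : Fin n // i ≤ j ∧ (¬ ∃ x ∈ A b, nodePlacement D ρ i x) ∧
      overwrite ρ (A b) (D i) = overwrite ρ (A b) (D j)})

/-! Multiaccess D2D coded caching. -/

/-- A packet of `ℓ` bits; addition is the bitwise XOR. -/
abbrev Packet (ℓ : ℕ) := Fin ℓ → ZMod 2

/-- A library of `N` files, each split into packets indexed by `Φ`. -/
abbrev Library (N : ℕ) (Φ : Type*) (ℓ : ℕ) := Fin N × Φ → Packet ℓ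

/-- The data of a scheme with users `U`, cache nodes `C` and message labels `Λ`. Placement is uncoded:
a node stores a set of packets, fixed before the demands are known. For each demand vector, finitely
many messages are sent, each of the size of one packet; a message has a sender and a content
computed from the library. -/
structure MADCCScheme (U C Φ Λ : Type*) (N ℓ : ℕ) where
  cached : C → Finset (Fin N × Φ)
  messages : (U → Fin N) → Finset Λ
  sender : (U → Fin N) → Λ → U
  content : (U → Fin N) → Λ → Library N Φ ℓ → Packet ℓ

/-- The two libraries agree on all packets that user `k` finds in the nodes it can access. -/
def MADCCScheme.SameView {U C Φ Λ : Type*} {N ℓ : ℕ} (σ : MADCCScheme U C Φ Λ N ℓ)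
    (access : U → Finset C) (k : U) (W W' : Library N Φ ℓ) : Prop :=
  ∀ c ∈ access k, ∀ p ∈ σ.cached c, W p = W' p

/-- `σ` is an `F`-division `(L, K, Γ, M, N)` multiaccess D2D coded caching scheme with access topology
`access`, one-shot delivery and worst-case transmission load `R`. -/
structure MADCCScheme.Achieves {U C Φ Λ : Type*} [Fintype U] [Fintype C] [Fintype Φ] {N ℓ : ℕ}
    (σ : MADCCScheme U C Φ Λ N ℓ) (access : U → Finset C) (F L K Γ : ℕ) (M R : ℝ) : Prop where
  users_card : Fintype.card U = K
  nodes_card : Fintype.card C = Γ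
  packets_card : Fintype.card Φ = F
  users_le_files : K ≤ N
  access_card : ∀ k, (access k).card = L
  access_injective : Function.Injective access
  memory_ge : (N : ℝ) / (L * K) ≤ M
  /-- Each node stores `M` files' worth of packets. -/
  memory : ∀ c, ((σ.cached c).card : ℝ) = M * F
  /-- The sender can compute its message from the cache contents it can access. -/
  encode : ∀ d, ∀ s ∈ σ.messages d, ∀ W W', σ.SameView access (σ.sender d s) W W' →
    σ.content d s W = σ.content d s W'
  /-- Each packet of the requested file is either in an accessible node, or determined by the
  accessible cache contents and a single message of another user. -/
  decode : ∀ d k f, (∃ c ∈ access k, (d k, f) ∈ σ.cached c) ∨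
    ∃ s ∈ σ.messages d, σ.sender d s ≠ k ∧ ∀ W W', σ.SameView access k W W' →
      σ.content d s W = σ.content d s W' → W (d k, f) = W' (d k, f)
  load : IsGreatest (Set.range fun d => ((σ.messages d).card : ℝ) / F) R

open scoped Classical in
/-- The scheme with placement array `Z` and delivery array `Q`: node `c` stores the packet `f` of every
file iff `Z f c`, and for each symbol `s` of `Q` user `φ s` sends the XOR of the packets
`(d k, f)` over all `f, k` with `Q f k = s`. -/
noncomputable def arrayScheme {U C Φ Λ : Type*} [Fintype U] [Fintype Φ] (N ℓ : ℕ)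
    (Z : Φ → C → Prop) (Q : Φ → U → Option Λ) (φ : Λ → U) : MADCCScheme U C Φ Λ N ℓ where
  cached c := Finset.univ.filter fun p => Z p.2 c
  messages _ := symbolSet Q
  sender _ s := φ s
  content d s W := ∑ p : Φ × U with Q p.1 p.2 = some s, W (d p.2, p.1)

/-!
Write points as pairs `(u, v)`, so that a transversal set of points is a vector `e` restricted to a
set of groups. Because the block size equals `t`, the blocks are exactly the transversal `t`-sets
(`IsGDD.existsUnique_block`): through a vector `e` there passes one block for each `t`-set of groups.

Let column `b` carry a symbol `(e, α)` in row `j`. Then `e` passes through the block `A b`, and row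
`j` of the orthogonal array differs from `e` exactly in the groups that `A b` meets
(`IsGDD.userRetrieve_eq_some_iff`). So the row and the symbol determine the column. If another column
`b'` carries the symbol too, then its block meets a group that `A b` does not; there row `j` agrees
with `e`, hence with a point of `A b'`, and the entry of row `j` in column `b'` is a star. This is the
condition on equal entries (`IsGDD.userRetrieve_distinct`).

For regularity, the vector `e` has to occur equally often in each of the `m.choose t` columns whose
blocks lie on `e`. That is, the number of rows that differ from `e` exactly in a `t`-set `U` of groups
must not depend on `U`. It does depend on `e`, namely on whether `e` is itself a row. For `U ≠ ∅`, the
strength `m - 1` fixes the number of rows that differ from `e` at most in `U`, and induction over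
subsets gives the claim (`IsOA.exists_card_rowsDifferingOn`). The number of symbols then follows by
counting the cells that are not stars by columns and by symbols
(`IsRegularArray.card_symbolSet_mul`), without evaluating these numbers.

The passage from a regular array to its transforms (`IsPDA.exists_isD2DTransform`,
`IsD2DTransform.isDPDA`) and from there to encoding and decoding (`IsDPDA.arrayScheme_encode`,
`IsDPDA.arrayScheme_decode`) is general and does not use the design.
-/

section

open Finset
open scoped Classical

/-! ### Counting rows of an orthogonal array -/

theorem natCard_subtype_eq_card_filter {α : Type*} [Fintype α] (p : α → Prop)
    [DecidablePred p] : Nat.card {x // p x} = #{x | p x} := by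
  rw [Nat.card_eq_fintype_card, Fintype.card_subtype]

/-- In an orthogonal array of index one, the entries in at most `t` columns can be restricted to
arbitrary sets independently. -/
theorem IsOA.card_rows_mem {Y : Type*} [Fintype Y] {t v r n : ℕ} {D : Fin n → Fin r → Y}
    (h : IsOA t v r 1 D) (hv : 1 ≤ v) (htr : t ≤ r) (C : Finset (Fin r)) (hC : #C ≤ t)
    (s : Fin r → Finset Y) :
    #{j | ∀ c ∈ C, D j c ∈ s c} = (∏ c ∈ C, #(s c)) * v ^ (t - #C) := by
  obtain ⟨C', hCC', hC'⟩ := Finset.exists_superset_card_eq hC (by simpa using htr)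
  -- outside `C` every symbol is admitted
  set s' : Fin r → Finset Y := fun c => if c ∈ C then s c else univ with hs'
  have hrows : ({j | ∀ c ∈ C, D j c ∈ s c} : Finset (Fin n)) =
      ({j | ∀ c ∈ C', D j c ∈ s' c} : Finset (Fin n)) := by
    ext j
    simp only [mem_filter, mem_univ, true_and, hs']
    constructor
    · intro hj c _
      by_cases hc : c ∈ C
      · simpa [hc] using hj c hc
      · simp [hc]
    · intro hj c hc
      simpa [hc] using hj c (hCC' hc)
  have hprod : ∏ c ∈ C', #(s' c) = (∏ c ∈ C, #(s c)) * v ^ (t - #C) := by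
    rw [← Finset.prod_sdiff hCC', mul_comm]
    congr 1
    · exact Finset.prod_congr rfl fun c hc => by simp [hs', hc]
    · rw [← hC', ← Finset.card_sdiff_of_subset hCC', ← Finset.prod_const]
      refine Finset.prod_congr rfl fun c hc => ?_
      simp [hs', (Finset.mem_sdiff.1 hc).2, h.symbols_card]
  rw [hrows, ← hprod, ← Finset.card_pi]
  have : Nonempty Y := Fintype.card_pos_iff.1 (by rw [h.symbols_card]; omega)
  refine Finset.card_bij (fun j _ c _ => D j c) ?_ ?_ ?_
  · intro j hj
    simpa using hj
  · intro i _ j _ hij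
    have h1 := h.strength C' hC' (D i)
    rw [natCard_subtype_eq_card_filter, Finset.card_eq_one] at h1
    -- `k` is the only row that agrees with row `i` on `C'`
    obtain ⟨k, hk⟩ := h1
    have hi : i ∈ ({k} : Finset (Fin n)) := by rw [← hk]; simp
    have hj : j ∈ ({k} : Finset (Fin n)) := by
      rw [← hk]
      simp only [mem_filter, mem_univ, true_and]
      exact fun c hc => (congrFun (congrFun hij c) hc).symm
    rw [mem_singleton.1 hi, mem_singleton.1 hj]
  · intro w hw
    have h1 := h.strength C' hC' fun c => if hc : c ∈ C' then w c hc else Classical.arbitrary Y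
    rw [natCard_subtype_eq_card_filter, Finset.card_eq_one] at h1
    obtain ⟨k, hk⟩ := h1
    have hk' : k ∈ ({k} : Finset (Fin n)) := mem_singleton_self k
    rw [← hk] at hk'
    have hkw : ∀ c (hc : c ∈ C'), D k c = w c hc := fun c hc => by
      simpa [hc] using (mem_filter.1 hk').2 c hc
    refine ⟨k, ?_, ?_⟩
    · simp only [mem_filter, mem_univ, true_and]
      intro c hc
      rw [hkw c hc]
      exact Finset.mem_pi.1 hw c hc
    · funext c hc
      exact hkw c hc

/-- The rows of `D` that differ from the vector `e` exactly in the positions in `U`. -/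
noncomputable def rowsDifferingOn {Y : Type*} {n r : ℕ} (D : Fin n → Fin r → Y) (e : Fin r → Y)
    (U : Finset (Fin r)) : Finset (Fin n) :=
  {j | ({u | D j u ≠ e u} : Finset (Fin r)) = U}

theorem mem_rowsDifferingOn {Y : Type*} {n r : ℕ} {D : Fin n → Fin r → Y} {e : Fin r → Y}
    {U : Finset (Fin r)} {j : Fin n} :
    j ∈ rowsDifferingOn D e U ↔ ∀ u, D j u ≠ e u ↔ u ∈ U := by
  simp [rowsDifferingOn, Finset.ext_iff]

theorem sum_card_rowsDifferingOn {Y : Type*} {n r : ℕ} (D : Fin n → Fin r → Y) (e : Fin r → Y)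
    (U : Finset (Fin r)) :
    ∑ V ∈ U.powerset, #(rowsDifferingOn D e V) = #{j | ∀ u ∈ Uᶜ, D j u ∈ ({e u} : Finset Y)} := by
  rw [Finset.card_eq_sum_card_fiberwise
    (f := fun j => ({u | D j u ≠ e u} : Finset (Fin r))) (t := U.powerset)]
  · refine Finset.sum_congr rfl fun V hV => ?_
    congr 1
    ext j
    simp only [rowsDifferingOn, mem_filter, mem_univ, true_and, mem_singleton, mem_compl]
    constructor
    · intro hj
      refine ⟨fun u hu => ?_, hj⟩
      by_contra hne
      exact hu (mem_powerset.1 hV (by rw [← hj]; simpa using hne))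
    · exact fun hj => hj.2
  · intro j hj
    simp only [coe_filter, mem_univ, true_and, mem_compl, mem_singleton, Set.mem_ofPred_eq] at hj
    simp only [coe_powerset, Set.mem_preimage, Set.mem_powerset_iff, coe_subset]
    intro u hu
    by_contra hne
    exact (mem_filter.1 hu).2 (hj u hne)

/-- In an array of strength `r - 1` with `r` columns, the number of rows that differ from `e` exactly
in `U` depends only on `e` and the size of `U`. By induction on the size: the rows that differ from
`e` at most in `U ≠ ∅` number `q ^ (#U - 1)`, and those that differ exactly in a given proper subset
of `U` are counted already. -/
theorem IsOA.exists_card_rowsDifferingOn {Y : Type*} [Fintype Y] {q r n : ℕ}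
    {D : Fin n → Fin r → Y} (h : IsOA (r - 1) q r 1 D) (hq : 1 ≤ q) (e : Fin r → Y) (k : ℕ) :
    ∃ c, ∀ U : Finset (Fin r), #U = k → #(rowsDifferingOn D e U) = c := by
  induction k using Nat.strong_induction_on with
  | _ k ih =>
  rcases Nat.eq_zero_or_pos k with rfl | hk
  · exact ⟨#(rowsDifferingOn D e ∅), fun U hU => by rw [Finset.card_eq_zero.1 hU]⟩
  choose c hc using ih
  -- the counts for smaller sizes, extended by zero
  set c' : ℕ → ℕ := fun i => if hi : i < k then c i hi else 0 with hc'
  refine ⟨q ^ (k - 1) - ∑ i ∈ range (k + 1), k.choose i • c' i, fun U hU => ?_⟩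
  have hUr : #U ≤ r := by simpa using Finset.card_le_univ U
  have hcompl : #Uᶜ = r - k := by rw [Finset.card_compl, Fintype.card_fin, hU]
  have hsum := sum_card_rowsDifferingOn D e U
  rw [h.card_rows_mem hq (by omega) Uᶜ (by omega) fun u => {e u}] at hsum
  simp only [card_singleton, Finset.prod_const_one, one_mul, hcompl] at hsum
  rw [show r - 1 - (r - k) = k - 1 by omega] at hsum
  have hsplit : ∑ V ∈ U.powerset, #(rowsDifferingOn D e V) =
      ∑ V ∈ U.powerset, ((if V = U then #(rowsDifferingOn D e U) else 0) + c' #V) := by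
    refine Finset.sum_congr rfl fun V hV => ?_
    by_cases hVU : V = U
    · simp [hVU, hc', hU]
    · have hlt : #V < k := by
        rw [← hU]
        exact Finset.card_lt_card ((mem_powerset.1 hV).ssubset_of_ne hVU)
      simp [hVU, hc', hlt, hc #V hlt V rfl]
  rw [hsplit, Finset.sum_add_distrib, Finset.sum_ite_eq' U.powerset U,
    if_pos (mem_powerset_self U), Finset.sum_powerset_apply_card c', hU] at hsum
  omega

/-! ### Occurrence numbers -/

/-- The occurrence numbers of the members of a finite set `H` run through `1, …, #H`. -/
theorem image_card_filter_le {α : Type*} [LinearOrder α] (H : Finset α) :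
    H.image (fun j => #{i ∈ H | i ≤ j}) = Finset.Icc 1 #H := by
  apply Finset.eq_of_subset_of_card_le
  · intro a ha
    obtain ⟨j, hj, rfl⟩ := Finset.mem_image.1 ha
    rw [Finset.mem_Icc]
    exact ⟨Finset.card_pos.2 ⟨j, by simp [hj]⟩, Finset.card_filter_le _ _⟩
  · rw [Finset.card_image_of_injOn, Nat.card_Icc, Nat.add_sub_cancel]
    intro i hi j hj hij
    have key : ∀ i ∈ H, ∀ j ∈ H, i < j → #{x ∈ H | x ≤ i} < #{x ∈ H | x ≤ j} := by
      intro i _ j hj hlt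
      apply Finset.card_lt_card
      refine Finset.ssubset_iff_subset_ne.2 ⟨fun x hx => ?_, fun heq => ?_⟩
      · simp only [mem_filter] at hx ⊢
        exact ⟨hx.1, hx.2.trans hlt.le⟩
      · have : j ∈ ({x ∈ H | x ≤ i} : Finset α) := by rw [heq]; simp [hj]
        exact absurd (mem_filter.1 this).2 (not_le.2 hlt)
    rcases lt_trichotomy i j with hlt | heq | hlt
    · exact absurd hij (key i hi j hj hlt).ne
    · exact heq
    · exact absurd hij (key j hj i hi hlt).ne'

theorem eq_of_card_filter_le_eq {α : Type*} [LinearOrder α] {H : Finset α} {i j : α} (hi : i ∈ H)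
    (hj : j ∈ H) (h : #{x ∈ H | x ≤ i} = #{x ∈ H | x ≤ j}) : i = j := by
  have hinj : Set.InjOn (fun j => #{i ∈ H | i ≤ j}) H := by
    rw [← Finset.card_image_iff, image_card_filter_le, Nat.card_Icc, Nat.add_sub_cancel]
  exact hinj hi hj h

/-! ### Transversal blocks -/

/-- The positions of the groups that the block `a` meets. -/
noncomputable def blockSupport {X Y : Type*} {m : ℕ} (ρ : X ≃ Fin m × Y) (a : Finset X) :
    Finset (Fin m) :=
  a.image fun x => (ρ x).1

/-- The vector `e` passes through all points of the block `a`. -/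
def Extends {X Y : Type*} {m : ℕ} (ρ : X ≃ Fin m × Y) (a : Finset X) (e : Fin m → Y) : Prop :=
  ∀ x ∈ a, e (ρ x).1 = (ρ x).2

theorem Extends.eq_image {X Y : Type*} {m : ℕ} {ρ : X ≃ Fin m × Y} {a : Finset X}
    {e : Fin m → Y} (h : Extends ρ a e) :
    a = (blockSupport ρ a).image fun u => ρ.symm (u, e u) := by
  have hpt : ∀ x ∈ a, ρ.symm ((ρ x).1, e (ρ x).1) = x := fun x hx => by
    rw [h x hx]
    exact ρ.symm_apply_apply x
  rw [blockSupport, Finset.image_image]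
  conv_lhs => rw [← Finset.image_id (s := a)]
  exact Finset.image_congr fun x hx => (hpt x hx).symm

section Block

variable {X Y B : Type*} [Fintype X] [Fintype B] {t m q : ℕ} {G : Fin m → Finset X}
  {A : B → Finset X} {ρ : X ≃ Fin m × Y}

theorem IsGDD.eq_of_fst_eq (hG : IsGDD t m q t 1 G A) (hρ : IsPointRepresentation G ρ) {b : B}
    {x y : X} (hx : x ∈ A b) (hy : y ∈ A b) (hxy : (ρ x).1 = (ρ y).1) : x = y :=
  hG.block_group b (ρ x).1 x hx y hy ((hρ x _).2 rfl) ((hρ y _).2 hxy.symm)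

theorem IsGDD.card_blockSupport (hG : IsGDD t m q t 1 G A) (hρ : IsPointRepresentation G ρ)
    (b : B) : #(blockSupport ρ (A b)) = t := by
  rw [blockSupport, Finset.card_image_of_injOn, hG.block_card]
  exact fun x hx y hy hxy => hG.eq_of_fst_eq hρ hx hy hxy

/-- Since the blocks have the size `t`, every transversal `t`-set is a block of its own. -/
theorem IsGDD.existsUnique_block (hG : IsGDD t m q t 1 G A) {T : Finset X} (hT : #T = t)
    (hT' : ∀ u, ∀ x ∈ T, ∀ y ∈ T, x ∈ G u → y ∈ G u → x = y) : ∃! b, A b = T := by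
  have h1 := hG.index_eq T hT hT'
  rw [natCard_subtype_eq_card_filter, Finset.card_eq_one] at h1
  obtain ⟨b, hb⟩ := h1
  have hb' : ∀ b', T ⊆ A b' ↔ b' = b := fun b' => by
    rw [← Finset.mem_singleton, ← hb]
    simp
  refine ⟨b, ?_, fun b' hb'' => (hb' b').1 hb''.ge⟩
  exact (Finset.eq_of_subset_of_card_le ((hb' b).2 rfl) (by rw [hG.block_card, hT])).symm

theorem IsGDD.block_injective (hG : IsGDD t m q t 1 G A) : Function.Injective A := fun _ b' h =>
  (hG.existsUnique_block (hG.block_card b') (hG.block_group b')).unique h rfl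

theorem IsGDD.eq_of_extends (hG : IsGDD t m q t 1 G A) {b b' : B} {e : Fin m → Y}
    (h : Extends ρ (A b) e) (h' : Extends ρ (A b') e)
    (hs : blockSupport ρ (A b) = blockSupport ρ (A b')) : b = b' := by
  apply hG.block_injective
  rw [h.eq_image, h'.eq_image, hs]

theorem IsGDD.exists_block_extends (hG : IsGDD t m q t 1 G A) (hρ : IsPointRepresentation G ρ)
    (e : Fin m → Y) {U : Finset (Fin m)} (hU : #U = t) :
    ∃ b, Extends ρ (A b) e ∧ blockSupport ρ (A b) = U := by
  have hinj : Function.Injective fun u => ρ.symm (u, e u) := fun u v huv =>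
    congrArg Prod.fst (ρ.symm.injective huv)
  obtain ⟨b, hb, -⟩ := hG.existsUnique_block (T := U.image fun u => ρ.symm (u, e u))
    (by rw [Finset.card_image_of_injective _ hinj, hU]) (by
      intro u x hx y hy hxu hyu
      obtain ⟨v, -, rfl⟩ := Finset.mem_image.1 hx
      obtain ⟨w, -, rfl⟩ := Finset.mem_image.1 hy
      have hv := (hρ _ _).1 hxu
      have hw := (hρ _ _).1 hyu
      simp only [Equiv.apply_symm_apply] at hv hw
      rw [hv, hw])
  refine ⟨b, fun x hx => ?_, ?_⟩
  · rw [hb] at hx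
    obtain ⟨v, -, rfl⟩ := Finset.mem_image.1 hx
    simp
  · rw [hb, blockSupport, Finset.image_image]
    conv_rhs => rw [← Finset.image_id (s := U)]
    exact Finset.image_congr fun u _ => by simp

theorem IsGDD.card_extends (hG : IsGDD t m q t 1 G A) (hρ : IsPointRepresentation G ρ)
    (e : Fin m → Y) : #{b | Extends ρ (A b) e} = m.choose t := by
  rw [show m.choose t = #(Finset.powersetCard t (univ : Finset (Fin m))) by simp]
  refine Finset.card_bij (fun b _ => blockSupport ρ (A b)) ?_ ?_ ?_
  · intro b _
    rw [Finset.mem_powersetCard]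
    exact ⟨Finset.subset_univ _, hG.card_blockSupport hρ b⟩
  · intro b hb b' hb' hs
    exact hG.eq_of_extends (mem_filter.1 hb).2 (mem_filter.1 hb').2 hs
  · intro U hU
    obtain ⟨b, hb, hbU⟩ := hG.exists_block_extends hρ e (Finset.mem_powersetCard.1 hU).2
    exact ⟨b, by simpa using hb, hbU⟩

/-- Count the pairs of a block and a vector through it in two ways. -/
theorem IsGDD.card_blocks [Fintype Y] (hG : IsGDD t m q t 1 G A)
    (hρ : IsPointRepresentation G ρ) (htm : t ≤ m) (hq : 1 ≤ q) (hY : Fintype.card Y = q) :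
    Fintype.card B = m.choose t * q ^ t := by
  have hvec : ∀ b, #{e | Extends ρ (A b) e} = q ^ (m - t) := by
    intro b
    have hpi : ({e | Extends ρ (A b) e} : Finset (Fin m → Y)) =
        Fintype.piFinset fun u => {y | ∀ x ∈ A b, (ρ x).1 = u → y = (ρ x).2} := by
      ext e
      rw [mem_filter, Fintype.mem_piFinset]
      simp only [mem_filter, mem_univ, true_and]
      exact ⟨fun h u x hx hxu => hxu ▸ h x hx, fun h x hx => h _ x hx rfl⟩
    have hcard : ∀ u, #{y : Y | ∀ x ∈ A b, (ρ x).1 = u → y = (ρ x).2} =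
        if u ∈ blockSupport ρ (A b) then 1 else q := by
      intro u
      split_ifs with hu
      · obtain ⟨x, hx, rfl⟩ := Finset.mem_image.1 hu
        rw [Finset.card_eq_one]
        refine ⟨(ρ x).2, ?_⟩
        ext y
        simp only [mem_filter, mem_univ, true_and, mem_singleton]
        refine ⟨fun h => h x hx rfl, fun h x' hx' hxx' => ?_⟩
        rw [h, hG.eq_of_fst_eq hρ hx' hx hxx']
      · rw [← hY, ← Finset.card_univ]
        congr 1
        refine Finset.filter_true_of_mem fun y _ x hx hxu => ?_
        exact absurd (Finset.mem_image.2 ⟨x, hx, hxu⟩) hu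
    rw [hpi, Fintype.card_piFinset, Finset.prod_congr rfl fun u _ => hcard u, Finset.prod_ite]
    simp only [Finset.prod_const_one, one_mul, Finset.prod_const]
    congr 1
    rw [Finset.filter_not, Finset.card_sdiff_of_subset (Finset.filter_subset _ _)]
    simp [hG.card_blockSupport hρ b]
  have hdc := Finset.sum_card_bipartiteAbove_eq_sum_card_bipartiteBelow
    (s := (univ : Finset B)) (t := (univ : Finset (Fin m → Y))) fun b e => Extends ρ (A b) e
  simp only [Finset.bipartiteAbove, Finset.bipartiteBelow, hvec, hG.card_extends hρ,
    Finset.sum_const, smul_eq_mul, Finset.card_univ, Fintype.card_fun, Fintype.card_fin, hY] at hdc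
  have hpow : q ^ m = q ^ t * q ^ (m - t) := by rw [← pow_add, Nat.add_sub_cancel' htm]
  refine Nat.eq_of_mul_eq_mul_right (pow_pos hq (m - t)) ?_
  rw [hdc, hpow]
  ring

/-- The groups have `q` points each, as many as there are symbols. -/
theorem IsGDD.exists_pointRepresentation [Fintype Y] {k lam : ℕ} (hG : IsGDD t m q k lam G A)
    (hY : Fintype.card Y = q) : ∃ ρ : X ≃ Fin m × Y, IsPointRepresentation G ρ := by
  choose γ hγ using hG.group_cover
  have hmem : ∀ x u, x ∈ G u ↔ γ x = u := fun x u => by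
    refine ⟨fun h => ?_, fun h => h ▸ hγ x⟩
    by_contra hne
    exact Finset.disjoint_left.1 (hG.group_disjoint _ _ hne) (hγ x) h
  have hfib : ∀ u, Nonempty ({x // γ x = u} ≃ Y) := fun u => by
    refine ⟨Fintype.equivOfCardEq ?_⟩
    rw [hY, Fintype.card_subtype, ← hG.group_card u]
    congr 1
    ext x
    simp [hmem]
  refine ⟨(Equiv.sigmaFiberEquiv γ).symm.trans
    ((Equiv.sigmaCongrRight fun u => (hfib u).some).trans (Equiv.sigmaEquivProd _ _)),
    fun x u => ?_⟩
  rw [hmem]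
  rfl

theorem card_points_of_equiv [Fintype Y] (ρ : X ≃ Fin m × Y) (hY : Fintype.card Y = q) :
    Fintype.card X = m * q := by
  rw [Fintype.card_congr ρ, Fintype.card_prod, Fintype.card_fin, hY]

end Block

/-! ### The user-retrieve array -/

theorem overwrite_apply_of_mem {X Y : Type*} {m : ℕ} {ρ : X ≃ Fin m × Y} {a : Finset X}
    (ha : ∀ x ∈ a, ∀ y ∈ a, (ρ x).1 = (ρ y).1 → x = y) (d : Fin m → Y) {x : X} (hx : x ∈ a) :
    overwrite ρ a d (ρ x).1 = (ρ x).2 := by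
  have h : ∃ v, ρ.symm ((ρ x).1, v) ∈ a := ⟨(ρ x).2, by simpa using hx⟩
  rw [overwrite, dif_pos h]
  have hx' : ρ.symm ((ρ x).1, h.choose) = x := ha _ h.choose_spec x hx (by simp)
  simpa using congrArg (fun y => (ρ y).2) hx'

theorem overwrite_apply_of_notMem {X Y : Type*} {m : ℕ} {ρ : X ≃ Fin m × Y} {a : Finset X}
    (d : Fin m → Y) {u : Fin m} (hu : u ∉ blockSupport ρ a) : overwrite ρ a d u = d u := by
  rw [overwrite, dif_neg]
  rintro ⟨v, hv⟩
  exact hu (Finset.mem_image.2 ⟨_, hv, by simp⟩)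

theorem overwrite_eq_iff {X Y : Type*} {m n : ℕ} {ρ : X ≃ Fin m × Y} {a : Finset X}
    (ha : ∀ x ∈ a, ∀ y ∈ a, (ρ x).1 = (ρ y).1 → x = y) (D : Fin n → Fin m → Y) (j : Fin n)
    (e : Fin m → Y) :
    ((¬ ∃ x ∈ a, nodePlacement D ρ j x) ∧ overwrite ρ a (D j) = e) ↔
      Extends ρ a e ∧ j ∈ rowsDifferingOn D e (blockSupport ρ a) := by
  rw [mem_rowsDifferingOn]
  constructor
  · rintro ⟨hstar, rfl⟩
    refine ⟨fun x hx => overwrite_apply_of_mem ha _ hx, fun u => ⟨fun hne => ?_, fun hu => ?_⟩⟩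
    · by_contra hu
      exact hne (overwrite_apply_of_notMem _ hu).symm
    · obtain ⟨x, hx, rfl⟩ := Finset.mem_image.1 hu
      rw [overwrite_apply_of_mem ha _ hx]
      exact fun h => hstar ⟨x, hx, h⟩
  · rintro ⟨he, hd⟩
    constructor
    · rintro ⟨x, hx, h⟩
      exact (hd _).2 (Finset.mem_image.2 ⟨x, hx, rfl⟩) (h.trans (he x hx).symm)
    · funext u
      by_cases hu : u ∈ blockSupport ρ a
      · obtain ⟨x, hx, rfl⟩ := Finset.mem_image.1 hu
        rw [overwrite_apply_of_mem ha _ hx, he x hx]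
      · rw [overwrite_apply_of_notMem _ hu]
        by_contra hne
        exact hu ((hd u).1 hne)

theorem userRetrieve_eq_none_iff {X Y B : Type*} {m n : ℕ} {D : Fin n → Fin m → Y}
    {ρ : X ≃ Fin m × Y} {A : B → Finset X} {j : Fin n} {b : B} :
    userRetrieve D ρ A j b = none ↔ ∃ x ∈ A b, nodePlacement D ρ j x := by
  rw [userRetrieve]
  split_ifs with h <;> simp [h]

section GDD

variable {X Y B : Type*} [Fintype X] [Fintype B] {t m q n : ℕ}
  {G : Fin m → Finset X} {A : B → Finset X} {ρ : X ≃ Fin m × Y} {D : Fin n → Fin m → Y}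

/-- The symbol `(e, α)` stands in column `b` at the `α`-th of those rows that differ from `e`
exactly in the groups that the block `A b` meets, provided that `e` passes through the block. -/
theorem IsGDD.userRetrieve_eq_some_iff (hG : IsGDD t m q t 1 G A)
    (hρ : IsPointRepresentation G ρ) {j : Fin n} {b : B} {s : (Fin m → Y) × ℕ} :
    userRetrieve D ρ A j b = some s ↔ Extends ρ (A b) s.1 ∧
      j ∈ rowsDifferingOn D s.1 (blockSupport ρ (A b)) ∧
      #{i ∈ rowsDifferingOn D s.1 (blockSupport ρ (A b)) | i ≤ j} = s.2 := by
  obtain ⟨e, α⟩ := s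
  have ha : ∀ x ∈ A b, ∀ y ∈ A b, (ρ x).1 = (ρ y).1 → x = y := fun x hx y hy =>
    hG.eq_of_fst_eq hρ hx hy
  have key := fun i => overwrite_eq_iff ha D i e
  have hcount : Extends ρ (A b) e →
      Nat.card {i : Fin n // i ≤ j ∧ (¬ ∃ x ∈ A b, nodePlacement D ρ i x) ∧
        overwrite ρ (A b) (D i) = e} =
      #{i ∈ rowsDifferingOn D e (blockSupport ρ (A b)) | i ≤ j} := by
    intro he
    rw [natCard_subtype_eq_card_filter]
    congr 1
    ext i
    simp only [mem_filter, mem_univ, true_and, key i, he]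
    exact and_comm
  rw [userRetrieve]
  split_ifs with h
  · simp only [false_iff]
    rintro ⟨he, hj, -⟩
    exact ((key j).2 ⟨he, hj⟩).1 h
  · rw [Option.some.injEq, Prod.mk.injEq]
    constructor
    · rintro ⟨rfl, hα⟩
      obtain ⟨he, hj⟩ := (overwrite_eq_iff ha D j _).1 ⟨h, rfl⟩
      exact ⟨he, hj, (hcount he).symm.trans hα⟩
    · rintro ⟨he, hj, hα⟩
      obtain ⟨-, hov⟩ := (key j).2 ⟨he, hj⟩
      refine ⟨hov, ?_⟩
      rw [hov]
      exact (hcount he).trans hα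

/-- The condition on equal entries holds because `e` and the row `j` determine the groups that the
block of the column meets, namely those where `D j` differs from `e`, and hence the block. -/
theorem IsGDD.userRetrieve_distinct (hG : IsGDD t m q t 1 G A) (hρ : IsPointRepresentation G ρ)
    {j₁ j₂ : Fin n} {b₁ b₂ : B} {s : (Fin m → Y) × ℕ} (h₁ : userRetrieve D ρ A j₁ b₁ = some s)
    (h₂ : userRetrieve D ρ A j₂ b₂ = some s) (hne : (j₁, b₁) ≠ (j₂, b₂)) :
    j₁ ≠ j₂ ∧ b₁ ≠ b₂ ∧ userRetrieve D ρ A j₁ b₂ = none ∧ userRetrieve D ρ A j₂ b₁ = none := by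
  rw [hG.userRetrieve_eq_some_iff hρ] at h₁ h₂
  obtain ⟨he₁, hj₁, hα₁⟩ := h₁
  obtain ⟨he₂, hj₂, hα₂⟩ := h₂
  have hb : b₁ ≠ b₂ := by
    rintro rfl
    exact hne (by rw [eq_of_card_filter_le_eq hj₁ hj₂ (hα₁.trans hα₂.symm)])
  have hs : blockSupport ρ (A b₁) ≠ blockSupport ρ (A b₂) := fun h =>
    hb (hG.eq_of_extends he₁ he₂ h)
  have hcard : #(blockSupport ρ (A b₁)) = #(blockSupport ρ (A b₂)) := by
    rw [hG.card_blockSupport hρ, hG.card_blockSupport hρ]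
  -- two supports of equal size: each has a group outside the other, where the row agrees with `e`
  have star : ∀ {i b b'}, i ∈ rowsDifferingOn D s.1 (blockSupport ρ (A b)) →
      Extends ρ (A b') s.1 → blockSupport ρ (A b) ≠ blockSupport ρ (A b') →
      #(blockSupport ρ (A b)) = #(blockSupport ρ (A b')) → userRetrieve D ρ A i b' = none := by
    intro i b b' hi he hs hcard
    rw [userRetrieve_eq_none_iff]
    have hsub : ¬ blockSupport ρ (A b') ⊆ blockSupport ρ (A b) := fun hsub =>
      hs (Finset.eq_of_subset_of_card_le hsub hcard.le).symm
    obtain ⟨u, hu', hu⟩ := Finset.not_subset.1 hsub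
    obtain ⟨x, hx, rfl⟩ := Finset.mem_image.1 hu'
    refine ⟨x, hx, ?_⟩
    rw [nodePlacement, ← he x hx]
    by_contra hne
    exact hu ((mem_rowsDifferingOn.1 hi _).1 hne)
  refine ⟨?_, hb, star hj₁ he₂ hs hcard, star hj₂ he₁ hs.symm hcard.symm⟩
  rintro rfl
  refine hs (Finset.ext fun u => ?_)
  rw [← mem_rowsDifferingOn.1 hj₁, ← mem_rowsDifferingOn.1 hj₂]

/-- A symbol `(e, α)` stands once in each column whose block lies on `e`: the number of rows that
carry the vector `e` is the same in all these columns, so that `α` is reached in all of them. -/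
theorem IsGDD.userRetrieve_regular [Fintype Y] (hG : IsGDD t m q t 1 G A)
    (hρ : IsPointRepresentation G ρ) (hOA : IsOA (m - 1) q m 1 D) (hq : 1 ≤ q) :
    IsRegularArray (userRetrieve D ρ A) (m.choose t) := by
  intro s hs
  obtain ⟨j₀, b₀, h₀⟩ := (mem_symbolSet _ _).1 hs
  have h₀' := (hG.userRetrieve_eq_some_iff hρ).1 h₀
  rw [natCard_subtype_eq_card_filter, ← hG.card_extends hρ s.1]
  refine Finset.card_bij (fun p _ => p.2) ?_ ?_ ?_
  · intro p hp
    simpa using ((hG.userRetrieve_eq_some_iff hρ).1 (mem_filter.1 hp).2).1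
  · intro p hp p' hp' hpp'
    by_contra hne
    exact (hG.userRetrieve_distinct hρ (mem_filter.1 hp).2 (mem_filter.1 hp').2 hne).2.1 hpp'
  · intro b hb
    have hb' : Extends ρ (A b) s.1 := (mem_filter.1 hb).2
    obtain ⟨c, hc⟩ := hOA.exists_card_rowsDifferingOn hq s.1 t
    have hcard : #(rowsDifferingOn D s.1 (blockSupport ρ (A b))) =
        #(rowsDifferingOn D s.1 (blockSupport ρ (A b₀))) := by
      rw [hc _ (hG.card_blockSupport hρ b), hc _ (hG.card_blockSupport hρ b₀)]
    have hα : s.2 ∈ Finset.Icc 1 #(rowsDifferingOn D s.1 (blockSupport ρ (A b₀))) := by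
      rw [← image_card_filter_le]
      exact Finset.mem_image.2 ⟨j₀, h₀'.2⟩
    rw [← hcard, ← image_card_filter_le] at hα
    obtain ⟨j, hj⟩ := Finset.mem_image.1 hα
    exact ⟨(j, b), by simpa using (hG.userRetrieve_eq_some_iff hρ).2 ⟨hb', hj⟩, rfl⟩

theorem IsGDD.card_userRetrieve_ne_none [Fintype Y] (hG : IsGDD t m q t 1 G A)
    (hρ : IsPointRepresentation G ρ) (hOA : IsOA (m - 1) q m 1 D) (htm : t < m) (hq : 1 ≤ q)
    (b : B) : #{j | userRetrieve D ρ A j b ≠ none} = (q - 1) ^ t * q ^ (m - 1 - t) := by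
  have hs := hG.card_blockSupport hρ b
  have hrows : ({j | userRetrieve D ρ A j b ≠ none} : Finset (Fin n)) =
      ({j | ∀ u ∈ blockSupport ρ (A b),
        D j u ∈ ({y | ∀ x ∈ A b, (ρ x).1 = u → y ≠ (ρ x).2} : Finset Y)} : Finset (Fin n)) := by
    ext j
    rw [mem_filter, mem_filter, Ne, userRetrieve_eq_none_iff]
    simp only [mem_univ, true_and, mem_filter, not_exists, not_and, nodePlacement]
    constructor
    · rintro h u - x hx rfl
      exact h x hx
    · exact fun h x hx => h _ (Finset.mem_image.2 ⟨x, hx, rfl⟩) x hx rfl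
  rw [hrows, hOA.card_rows_mem hq (by omega) _ (by omega), hs]
  congr 1
  rw [← hs, ← Finset.prod_const]
  refine Finset.prod_congr rfl fun u hu => ?_
  obtain ⟨x, hx, rfl⟩ := Finset.mem_image.1 hu
  rw [← hOA.symbols_card, ← Finset.card_univ, ← Finset.card_erase_of_mem (mem_univ (ρ x).2)]
  congr 1
  ext y
  simp only [mem_filter, mem_univ, true_and, mem_erase, and_true]
  refine ⟨fun h => h x hx rfl, fun h x' hx' hxx' => ?_⟩
  rwa [hG.eq_of_fst_eq hρ hx' hx hxx']

end GDD

/-! ### Regular placement delivery arrays and their transforms -/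

section Array

variable {Φ U Λ : Type*} {P : Φ → U → Option Λ} {K F Z S g : ℕ}

theorem IsD2DTransform.eq_none_iff {Q : Φ × Fin g → U → Option (Λ × U)}
    (hQ : IsD2DTransform P Q) {f : Φ × Fin g} {k : U} : Q f k = none ↔ P f.1 k = none := by
  refine ⟨fun h => ?_, fun h => hQ.star _ _ _ h⟩
  by_contra hne
  obtain ⟨s, hs⟩ := Option.ne_none_iff_exists'.1 hne
  obtain ⟨k', -, -, h'⟩ := (hQ.entry _ _ _ hs).mapsTo (Set.mem_univ f.2)
  exact absurd (h.symm.trans h') (by simp)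

theorem IsD2DTransform.eq_some {Q : Φ × Fin g → U → Option (Λ × U)}
    (hQ : IsD2DTransform P Q) {f : Φ × Fin g} {k : U} {s : Λ × U} (h : Q f k = some s) :
    P f.1 k = some s.1 ∧ s.2 ≠ k ∧ ∃ j', P j' s.2 = some s.1 := by
  have hne : P f.1 k ≠ none := fun h' => by
    rw [hQ.eq_none_iff.2 h'] at h
    simp at h
  obtain ⟨s', hs'⟩ := Option.ne_none_iff_exists'.1 hne
  obtain ⟨k', hk', hj', h'⟩ := (hQ.entry _ _ _ hs').mapsTo (Set.mem_univ f.2)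
  obtain rfl : s = (s', k') := Option.some.inj (h.symm.trans h')
  exact ⟨hs', hk', hj'⟩

variable [Fintype Φ] [Fintype U]

/-- Count the cells that are not stars by symbols and by columns. -/
theorem IsRegularArray.card_symbolSet_mul (h : IsRegularArray P g) :
    #(symbolSet P) * g = ∑ k, #{j | P j k ≠ none} := by
  have h1 : ∑ k, #{j | P j k ≠ none} = #{p : Φ × U | P p.1 p.2 ≠ none} := by
    rw [Finset.card_eq_sum_card_fiberwise (f := Prod.snd) (t := univ) fun _ _ => mem_univ _]
    refine Finset.sum_congr rfl fun k _ => Finset.card_bij (fun j _ => (j, k)) ?_ ?_ ?_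
    · intro j hj
      simpa using hj
    · intro i _ j _ hij
      exact congrArg Prod.fst hij
    · rintro ⟨j, k'⟩ hj
      simp only [mem_filter, mem_univ, true_and] at hj
      obtain ⟨hj, rfl⟩ := hj
      exact ⟨j, by simpa using hj, rfl⟩
  have h2 : #{p : Φ × U | P p.1 p.2 ≠ none} =
      ∑ o ∈ (symbolSet P).map Function.Embedding.some, #{p : Φ × U | P p.1 p.2 = o} := by
    rw [Finset.card_eq_sum_card_fiberwise (f := fun p => P p.1 p.2)
      (t := (symbolSet P).map Function.Embedding.some)]
    · refine Finset.sum_congr rfl fun o ho => ?_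
      obtain ⟨s, -, rfl⟩ := Finset.mem_map.1 ho
      congr 1
      ext p
      simp only [mem_filter, mem_univ, true_and, Function.Embedding.some_apply]
      refine ⟨fun hp => hp.2, fun hp => ⟨by simp [hp], hp⟩⟩
    · intro p hp
      obtain ⟨s, hs⟩ := Option.ne_none_iff_exists'.1 (mem_filter.1 hp).2
      simp only [coe_map, Set.mem_image, SetLike.mem_coe]
      exact ⟨s, (mem_symbolSet _ _).2 ⟨_, _, hs⟩, hs.symm⟩
  rw [h1, h2, Finset.sum_map, Finset.sum_congr rfl fun s hs => ?_, Finset.sum_const, smul_eq_mul]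
  rw [← h s hs, natCard_subtype_eq_card_filter]
  rfl

/-- A symbol stands at most once in a column, so it occurs in `g` columns. -/
theorem IsPDA.card_columns (hP : IsPDA P K F Z S) (hg : IsRegularArray P g) {s : Λ}
    (hs : s ∈ symbolSet P) : #{k | ∃ j, P j k = some s} = g := by
  rw [← hg s hs, natCard_subtype_eq_card_filter]
  symm
  refine Finset.card_bij (fun p _ => p.2) ?_ ?_ ?_
  · intro p hp
    simpa using ⟨p.1, (mem_filter.1 hp).2⟩
  · intro p hp p' hp' hpp'
    by_contra hne
    exact (hP.distinct _ _ _ _ s (mem_filter.1 hp).2 (mem_filter.1 hp').2 hne).2.1 hpp'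
  · intro k hk
    obtain ⟨j, hj⟩ := (mem_filter.1 hk).2
    exact ⟨(j, k), by simpa using hj, rfl⟩

/-- An entry has as many copies to be replaced as there are other columns that contain it. -/
theorem IsPDA.exists_isD2DTransform (hP : IsPDA P K F Z S) (hg : IsRegularArray P g) :
    ∃ Q : Φ × Fin (g - 1) → U → Option (Λ × U), IsD2DTransform P Q := by
  have hbij : ∀ k s, (∃ j, P j k = some s) → ∃ f : Fin (g - 1) → U,
      Set.BijOn f Set.univ {k' | k' ≠ k ∧ ∃ j', P j' k' = some s} := by
    intro k s hks
    have hs : s ∈ symbolSet P := (mem_symbolSet _ _).2 (by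
      obtain ⟨j, hj⟩ := hks
      exact ⟨j, k, hj⟩)
    have hcard : #(({k' | ∃ j', P j' k' = some s} : Finset U).erase k) = g - 1 := by
      rw [Finset.card_erase_of_mem (by simpa using hks), hP.card_columns hg hs]
    refine ⟨fun a => (Finset.equivFinOfCardEq hcard).symm a, ?_, ?_, ?_⟩
    · intro a _
      obtain ⟨hne, hmem⟩ := Finset.mem_erase.1 ((Finset.equivFinOfCardEq hcard).symm a).2
      exact ⟨hne, (mem_filter.1 hmem).2⟩
    · exact fun a _ a' _ h => (Equiv.injective _) (Subtype.ext h)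
    · intro k' hk'
      have hmem : k' ∈ ({k' | ∃ j', P j' k' = some s} : Finset U).erase k := by simpa using hk'
      exact ⟨Finset.equivFinOfCardEq hcard ⟨k', hmem⟩, trivial, by simp⟩
  choose f hf using hbij
  have hex : ∀ j k, ∃ r : Fin (g - 1) → Option (Λ × U), (P j k = none → ∀ a, r a = none) ∧
      ∀ s, P j k = some s → Set.BijOn r Set.univ
        {o | ∃ k', k' ≠ k ∧ (∃ j', P j' k' = some s) ∧ o = some (s, k')} := by
    intro j k
    rcases h : P j k with _ | s
    · exact ⟨fun _ => none, fun _ _ => rfl, by simp⟩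
    · refine ⟨fun a => some (s, f k s ⟨j, h⟩ a), by simp, ?_⟩
      rintro s' hs'
      obtain rfl : s = s' := by simpa using hs'
      obtain ⟨h1, h2, h3⟩ := hf k s ⟨j, h⟩
      refine ⟨fun a ha => ⟨_, (h1 ha).1, (h1 ha).2, rfl⟩, fun a ha a' ha' haa' => ?_, ?_⟩
      · exact h2 ha ha' (by simpa using haa')
      · rintro o ⟨k', hk', hj', rfl⟩
        obtain ⟨a, ha, rfl⟩ := h3 ⟨hk', hj'⟩
        exact ⟨a, ha, rfl⟩
  choose r hr hr' using hex
  exact ⟨fun p k => r p.1 k p.2, ⟨fun j a k h => hr j k h a, fun j k s h => hr' j k s h⟩⟩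

theorem IsD2DTransform.mem_symbolSet_iff {Q : Φ × Fin g → U → Option (Λ × U)}
    (hQ : IsD2DTransform P Q) (hP : IsPDA P K F Z S) (hg : IsRegularArray P (g + 1)) (hg1 : 1 ≤ g)
    {s : Λ × U} : s ∈ symbolSet Q ↔ s.1 ∈ symbolSet P ∧ ∃ j, P j s.2 = some s.1 := by
  constructor
  · intro h
    obtain ⟨f, k, hf⟩ := (mem_symbolSet _ _).1 h
    obtain ⟨h1, -, h3⟩ := hQ.eq_some hf
    exact ⟨(mem_symbolSet _ _).2 ⟨_, _, h1⟩, h3⟩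
  · rintro ⟨hs, hj⟩
    -- the message is needed in some column other than that of its sender
    obtain ⟨k, hk, hne⟩ := Finset.exists_mem_ne
      (by rw [hP.card_columns hg hs]; omega : 1 < #{k | ∃ j, P j k = some s.1}) s.2
    obtain ⟨j', hj'⟩ := (mem_filter.1 hk).2
    obtain ⟨a, -, ha⟩ := (hQ.entry _ _ _ hj').surjOn ⟨s.2, hne.symm, hj, rfl⟩
    exact (mem_symbolSet _ _).2 ⟨(j', a), k, ha⟩

theorem IsD2DTransform.isDPDA {Q : Φ × Fin g → U → Option (Λ × U)} (hQ : IsD2DTransform P Q)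
    (hP : IsPDA P K F Z S) (hg : IsRegularArray P (g + 1)) (hg1 : 1 ≤ g) :
    IsDPDA Q Prod.snd K (g * F) (g * Z) ((g + 1) * S) where
  columns_card := hP.columns_card
  rows_card := by rw [Fintype.card_prod, Fintype.card_fin, hP.rows_card, mul_comm]
  stars k := by
    rw [← hP.stars k, natCard_subtype_eq_card_filter, natCard_subtype_eq_card_filter]
    have : ({f | Q f k = none} : Finset (Φ × Fin g)) =
        ({j | P j k = none} : Finset Φ) ×ˢ univ := by
      ext f
      simp [hQ.eq_none_iff]
    rw [this, Finset.card_product, Finset.card_univ, Fintype.card_fin, mul_comm]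
  symbols := by
    rw [← hP.symbols, Finset.card_eq_sum_card_fiberwise (f := Prod.fst) (t := symbolSet P)
      fun s hs => ((hQ.mem_symbolSet_iff hP hg hg1).1 hs).1, mul_comm, ← smul_eq_mul,
      ← Finset.sum_const]
    refine Finset.sum_congr rfl fun s hs => ?_
    rw [← hP.card_columns hg hs]
    symm
    refine Finset.card_bij (fun k _ => (s, k)) ?_ ?_ ?_
    · intro k hk
      rw [mem_filter]
      exact ⟨(hQ.mem_symbolSet_iff hP hg hg1).2 ⟨hs, (mem_filter.1 hk).2⟩, rfl⟩
    · intro k _ k' _ h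
      exact congrArg Prod.snd h
    · rintro ⟨s', k⟩ hmem
      obtain ⟨h, rfl⟩ := mem_filter.1 hmem
      exact ⟨k, by simpa using ((hQ.mem_symbolSet_iff hP hg hg1).1 h).2, rfl⟩
  distinct := by
    intro f₁ k₁ f₂ k₂ s h₁ h₂ hne
    have hP₁ := (hQ.eq_some h₁).1
    have hP₂ := (hQ.eq_some h₂).1
    have hcell : (f₁.1, k₁) ≠ (f₂.1, k₂) := by
      intro h
      obtain ⟨hf, rfl⟩ := Prod.mk.inj h
      have h₂' : Q (f₁.1, f₂.2) k₁ = some s := by rw [hf]; exact h₂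
      have ha : f₁.2 = f₂.2 := (hQ.entry _ _ _ hP₁).injOn (Set.mem_univ _) (Set.mem_univ _)
        (h₁.trans h₂'.symm)
      exact hne (by rw [Prod.ext hf ha])
    obtain ⟨hj, hk, h12, h21⟩ := hP.distinct _ _ _ _ _ hP₁ hP₂ hcell
    exact ⟨fun h => hj (congrArg Prod.fst h), hk, hQ.eq_none_iff.2 h12, hQ.eq_none_iff.2 h21⟩
  sender := by
    intro f k s h
    obtain ⟨h1, hne, j', hj'⟩ := hQ.eq_some h
    exact hQ.eq_none_iff.2
      (hP.distinct _ _ _ _ _ h1 hj' fun h => hne (congrArg Prod.snd h).symm).2.2.1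

end Array

/-! ### The scheme of a placement array and a delivery array -/

section Scheme

variable {U C Φ Λ : Type*} [Fintype U] [Fintype Φ] {N ℓ K F Z S : ℕ} {access : U → Finset C}
  {pl : Φ → C → Prop} {Q : Φ → U → Option Λ} {φ : Λ → U}

/-- The sender of a message finds all its summands in the nodes it accesses. -/
theorem IsDPDA.arrayScheme_encode (hQ : IsDPDA Q φ K F Z S)
    (hstar : ∀ f k, Q f k = none → ∃ c ∈ access k, pl f c) (d : U → Fin N) (s : Λ)
    (W W' : Library N Φ ℓ)
    (hW : (arrayScheme N ℓ pl Q φ).SameView access (φ s) W W') :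
    (arrayScheme N ℓ pl Q φ).content d s W = (arrayScheme N ℓ pl Q φ).content d s W' := by
  refine Finset.sum_congr rfl fun p hp => ?_
  obtain ⟨c, hc, hpc⟩ := hstar _ _ (hQ.sender _ _ _ (mem_filter.1 hp).2)
  exact hW c hc _ (by simpa [arrayScheme] using hpc)

/-- A user that lacks a packet is served by the message of the corresponding symbol: it has all the
other summands, by the condition on equal entries. -/
theorem IsDPDA.arrayScheme_decode (hQ : IsDPDA Q φ K F Z S)
    (hstar : ∀ f k, Q f k = none → ∃ c ∈ access k, pl f c) (d : U → Fin N) (k : U) (f : Φ) :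
    (∃ c ∈ access k, (d k, f) ∈ (arrayScheme N ℓ pl Q φ).cached c) ∨
      ∃ s ∈ (arrayScheme N ℓ pl Q φ).messages d, (arrayScheme N ℓ pl Q φ).sender d s ≠ k ∧
        ∀ W W', (arrayScheme N ℓ pl Q φ).SameView access k W W' →
          (arrayScheme N ℓ pl Q φ).content d s W = (arrayScheme N ℓ pl Q φ).content d s W' →
          W (d k, f) = W' (d k, f) := by
  rcases h : Q f k with _ | s
  · obtain ⟨c, hc, hf⟩ := hstar f k h
    exact Or.inl ⟨c, hc, by simpa [arrayScheme] using hf⟩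
  · refine Or.inr ⟨s, (mem_symbolSet _ _).2 ⟨f, k, h⟩, ?_, fun W W' hW hs => ?_⟩
    · intro hk
      have hk : φ s = k := hk
      have := hQ.sender _ _ _ h
      rw [hk, h] at this
      simp at this
    · simp only [arrayScheme] at hs
      have hmem : (f, k) ∈ ({p : Φ × U | Q p.1 p.2 = some s} : Finset (Φ × U)) := by simpa using h
      rw [← Finset.add_sum_erase _ _ hmem, ← Finset.add_sum_erase _ _ hmem] at hs
      rw [Finset.sum_congr rfl fun p hp => ?_] at hs
      · exact add_right_cancel hs
      · obtain ⟨hne, hp⟩ := Finset.mem_erase.1 hp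
        obtain ⟨c, hc, hpc⟩ := hstar _ _
          (hQ.distinct _ _ _ _ s (mem_filter.1 hp).2 h hne).2.2.1
        exact hW c hc _ (by simpa [arrayScheme] using hpc)

theorem card_arrayScheme_cached (c : C) :
    #((arrayScheme N ℓ pl Q φ).cached c) = N * #{f | pl f c} := by
  have : (arrayScheme N ℓ pl Q φ).cached c =
      (univ : Finset (Fin N)) ×ˢ ({f | pl f c} : Finset Φ) := by
    ext p
    simp [arrayScheme]
  rw [this, Finset.card_product, Finset.card_univ, Fintype.card_fin]

theorem arrayScheme_load [Nonempty (U → Fin N)] (hS : #(symbolSet Q) = S) :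
    IsGreatest (Set.range fun d => (((arrayScheme N ℓ pl Q φ).messages d).card : ℝ) / F)
      ((S : ℝ) / F) := by
  have : (fun d => (((arrayScheme N ℓ pl Q φ).messages d).card : ℝ) / F) =
      fun _ => (S : ℝ) / F := by
    funext d
    rw [← hS]
    rfl
  rw [this, Set.range_const]
  exact isGreatest_singleton

end Scheme

/-! ### The scheme of a group divisible design and an orthogonal array -/

/-- The number of packets of each file, out of `g` for each row, that a node stores. -/
theorem IsOA.card_nodePlacement {X Y : Type*} [Fintype Y] {m q n : ℕ} {D : Fin n → Fin m → Y}
    {ρ : X ≃ Fin m × Y} (hOA : IsOA (m - 1) q m 1 D) (hm : 2 ≤ m) (hq : 1 ≤ q) (x : X) (g : ℕ) :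
    #{f : Fin n × Fin g | nodePlacement D ρ f.1 x} = q ^ (m - 2) * g := by
  have h := hOA.card_rows_mem hq (by omega) {(ρ x).1} (by simp; omega) fun _ => {(ρ x).2}
  simp only [mem_singleton, forall_eq, Finset.prod_singleton, card_singleton, one_mul] at h
  have hprod : ({f | nodePlacement D ρ f.1 x} : Finset (Fin n × Fin g)) =
      ({j | D j (ρ x).1 = (ρ x).2} : Finset (Fin n)) ×ˢ univ := by
    ext f
    rw [mem_filter, Finset.mem_product, mem_filter]
    simp [nodePlacement]
  rw [hprod, Finset.card_product, h, Finset.card_univ, Fintype.card_fin, Nat.sub_sub]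

section Main

variable {X Y B : Type*} [Fintype X] [Fintype Y] [Fintype B] {t m q n : ℕ}
  {G : Fin m → Finset X} {A : B → Finset X} {ρ : X ≃ Fin m × Y} {D : Fin n → Fin m → Y}

theorem IsGDD.userRetrieve_isPDA (hG : IsGDD t m q t 1 G A) (hρ : IsPointRepresentation G ρ)
    (hOA : IsOA (m - 1) q m 1 D) (htm : t < m) (hq : 1 ≤ q) :
    IsPDA (userRetrieve D ρ A) (m.choose t * q ^ t) (q ^ (m - 1))
      (q ^ (m - 1) - (q - 1) ^ t * q ^ (m - 1 - t)) ((q - 1) ^ t * q ^ (m - 1)) where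
  columns_card := hG.card_blocks hρ htm.le hq hOA.symbols_card
  rows_card := by rw [Fintype.card_fin, hOA.rows_card, one_mul]
  stars b := by
    have h := Finset.card_filter_add_card_filter_not (s := (univ : Finset (Fin n)))
      fun j => userRetrieve D ρ A j b = none
    have h' := hG.card_userRetrieve_ne_none hρ hOA htm hq b
    have hn := hOA.rows_card
    rw [Finset.card_univ, Fintype.card_fin] at h
    rw [one_mul] at hn
    rw [natCard_subtype_eq_card_filter]
    simp only [ne_eq] at h'
    omega
  symbols := by
    -- count the cells that are not stars by symbols and by columns
    have h := (hG.userRetrieve_regular hρ hOA hq).card_symbolSet_mul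
    simp only [hG.card_userRetrieve_ne_none hρ hOA htm hq, Finset.sum_const, smul_eq_mul,
      Finset.card_univ, hG.card_blocks hρ htm.le hq hOA.symbols_card] at h
    have hpow : q ^ (m - 1) = q ^ t * q ^ (m - 1 - t) := by
      rw [← pow_add]
      congr 1
      omega
    refine Nat.eq_of_mul_eq_mul_right (Nat.choose_pos htm.le) ?_
    rw [h, hpow]
    ring
  distinct _ _ _ _ _ h₁ h₂ hne := hG.userRetrieve_distinct hρ h₁ h₂ hne

/-- The user-retrieve array only enters through its transform `Q`: the stars of `Q` mark the packets
that a user can access, and the number of its symbols is the load. -/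
theorem IsGDD.arrayScheme_achieves (hG : IsGDD t m q t 1 G A)
    (hOA : IsOA (m - 1) q m 1 D) (ht : 1 ≤ t) (htm : t < m) (hq : 1 ≤ q) {g : ℕ}
    (hg : m.choose t = g + 1) (hg1 : 1 ≤ g) {Z : ℕ}
    {Q : Fin n × Fin g → B → Option (((Fin m → Y) × ℕ) × B)}
    (hQ : IsDPDA Q Prod.snd (m.choose t * q ^ t) (g * q ^ (m - 1)) Z
      (m.choose t * ((q - 1) ^ t * q ^ (m - 1))))
    (hstar : ∀ f b, Q f b = none → ∃ x ∈ A b, nodePlacement D ρ f.1 x)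
    (N ℓ : ℕ) (hN : m.choose t * q ^ t ≤ N) :
    (arrayScheme N ℓ (fun f x => nodePlacement D ρ f.1 x) Q Prod.snd).Achieves A
      (g * q ^ (m - 1)) t (m.choose t * q ^ t) (m * q) ((N : ℝ) / q)
      ((m.choose t : ℝ) * ((q : ℝ) - 1) ^ t / ((m.choose t : ℝ) - 1)) where
  users_card := hQ.columns_card
  nodes_card := card_points_of_equiv ρ hOA.symbols_card
  packets_card := hQ.rows_card
  users_le_files := hN
  access_card := hG.block_card
  access_injective := hG.block_injective
  memory_ge := by
    apply div_le_div_of_nonneg_left (Nat.cast_nonneg N) (by exact_mod_cast hq)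
    have h1 : q ^ 1 ≤ q ^ t := Nat.pow_le_pow_right hq ht
    have h2 : 1 ≤ t * m.choose t := Nat.mul_pos ht (Nat.choose_pos htm.le)
    have h3 : q ≤ t * (m.choose t * q ^ t) := by
      calc q = 1 * q ^ 1 := by ring
        _ ≤ (t * m.choose t) * q ^ t := Nat.mul_le_mul h2 h1
        _ = _ := by ring
    exact_mod_cast h3
  memory x := by
    rw [card_arrayScheme_cached, hOA.card_nodePlacement (by omega) hq]
    have hq' : (q : ℝ) ≠ 0 := by exact_mod_cast (by omega : q ≠ 0)
    have hpow : q ^ (m - 1) = q ^ (m - 2) * q := by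
      rw [← pow_succ]
      congr 1
      omega
    rw [hpow]
    push_cast
    field_simp
  encode d s _ W W' hW := hQ.arrayScheme_encode hstar d s W W' hW
  decode d k f := hQ.arrayScheme_decode hstar d k f
  load := by
    have hNpos : 0 < N :=
      (Nat.mul_pos (Nat.choose_pos htm.le) (pow_pos hq t)).trans_le hN
    have : Nonempty (B → Fin N) := ⟨fun _ => ⟨0, hNpos⟩⟩
    have h := arrayScheme_load (N := N) (ℓ := ℓ) (pl := fun f x => nodePlacement D ρ f.1 x)
      (φ := Prod.snd) (F := g * q ^ (m - 1)) hQ.symbols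
    convert h using 1
    have hq' : (q : ℝ) ≠ 0 := by exact_mod_cast (by omega : q ≠ 0)
    have hg' : (g : ℝ) ≠ 0 := by exact_mod_cast (by omega : g ≠ 0)
    rw [hg]
    push_cast [Nat.cast_sub hq]
    rw [add_sub_cancel_right]
    field_simp

end Main

end

theorem mainTheorem6 {X Y B : Type*} [Fintype X] [Fintype Y] [Fintype B]
    (t m q n : ℕ) (ht : 1 ≤ t) (htm : t < m) (hq : 1 ≤ q)
    (G : Fin m → Finset X) (A : B → Finset X) (hGDD : IsGDD t m q t 1 G A)
    (D : Fin n → Fin m → Y) (hOA : IsOA (m - 1) q m 1 D) :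
    (∃ ρ : X ≃ Fin m × Y, IsPointRepresentation G ρ) ∧
    ∀ ρ : X ≃ Fin m × Y, IsPointRepresentation G ρ →
      -- the user-retrieve array is a regular PDA
      IsPDA (userRetrieve D ρ A) (m.choose t * q ^ t) (q ^ (m - 1))
        (q ^ (m - 1) - (q - 1) ^ t * q ^ (m - 1 - t)) ((q - 1) ^ t * q ^ (m - 1)) ∧
      IsRegularArray (userRetrieve D ρ A) (m.choose t) ∧
      -- it can be transformed, and every transform is a DPDA that yields the scheme
      (∃ Q : Fin n × Fin (m.choose t - 1) → B → Option (((Fin m → Y) × ℕ) × B),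
        IsD2DTransform (userRetrieve D ρ A) Q) ∧
      ∀ Q : Fin n × Fin (m.choose t - 1) → B → Option (((Fin m → Y) × ℕ) × B),
        IsD2DTransform (userRetrieve D ρ A) Q →
        IsDPDA Q Prod.snd (m.choose t * q ^ t) ((m.choose t - 1) * q ^ (m - 1))
          ((m.choose t - 1) * (q ^ (m - 1) - (q - 1) ^ t * q ^ (m - 1 - t)))
          (m.choose t * ((q - 1) ^ t * q ^ (m - 1))) ∧
        (∀ f b, Q f b = none ↔ ∃ x ∈ A b, nodePlacement D ρ f.1 x) ∧
        ∀ N ℓ : ℕ, m.choose t * q ^ t ≤ N →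
          ∃ M : ℝ, M / N = 1 / q ∧
            (arrayScheme N ℓ (fun f x => nodePlacement D ρ f.1 x) Q Prod.snd).Achieves A
              ((m.choose t - 1) * q ^ (m - 1)) t (m.choose t * q ^ t) (m * q) M
              ((m.choose t : ℝ) * ((q : ℝ) - 1) ^ t / ((m.choose t : ℝ) - 1)) := by
  refine ⟨hGDD.exists_pointRepresentation hOA.symbols_card, fun ρ hρ => ?_⟩
  have hP := hGDD.userRetrieve_isPDA hρ hOA htm hq
  have hreg := hGDD.userRetrieve_regular hρ hOA hq
  -- `1 ≤ t < m` leaves at least one other column for each entry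
  have hchoose : 2 ≤ m.choose t := by
    obtain ⟨k, rfl⟩ : ∃ k, m = k + 1 := ⟨m - 1, by omega⟩
    obtain ⟨i, rfl⟩ : ∃ i, t = i + 1 := ⟨t - 1, by omega⟩
    rw [Nat.choose_succ_succ']
    have h1 : 0 < k.choose i := Nat.choose_pos (by omega)
    have h2 : 0 < k.choose (i + 1) := Nat.choose_pos (by omega)
    omega
  have hg : m.choose t = m.choose t - 1 + 1 := by omega
  refine ⟨hP, hreg, hP.exists_isD2DTransform hreg, fun Q hQ => ?_⟩
  have hDPDA := hQ.isDPDA hP (by rwa [← hg]) (by omega)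
  rw [← hg] at hDPDA
  have hstar : ∀ f b, Q f b = none ↔ ∃ x ∈ A b, nodePlacement D ρ f.1 x := fun f b =>
    hQ.eq_none_iff.trans userRetrieve_eq_none_iff
  refine ⟨hDPDA, hstar, fun N ℓ hN => ⟨(N : ℝ) / q, ?_, ?_⟩⟩
  · have hN' : (N : ℝ) ≠ 0 := by
      have := (Nat.mul_pos (Nat.choose_pos htm.le) (pow_pos hq t)).trans_le hN
      exact_mod_cast this.ne'
    field_simp
  · exact hGDD.arrayScheme_achieves hOA ht htm hq hg (by omega) hDPDA
      (fun f b => (hstar f b).1) N ℓ hN
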